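/- Let $F$ be an algebraically closed field of characteristic zero, let $(p_{ij})_{1\le i,j\le n}$ be a matrix with entries in $F^*=F\setminus\{0\}$, and let $V$ be the $F$-vector space with basis $x_1,\dots,x_n$ and braiding $C(x_i\otimes x_j)=p_{ij}\,x_j\otimes x_i$ (a braided vector space of diagonal type). Let $\mathfrak B(V)=T(V)/\bigoplus_{m}\ker S_m$ be its Nichols algebra, where $S_m=\sum_{\sigma\in\mathbb S_m}T_\sigma$ is the quantum symmetrizer on $V^{\otimes m}$ and $T_\sigma$ is the operator obtained from a reduced expression of $\sigma$ by letting simple transpositions act through $C$ on adjacent tensor factors. The algebra $\mathfrak B(V)$ is $\mathbb Z^n$-graded with $\deg x_i=e_i$; let $\chi$ be the bicharacter on $\mathbb Z^n$ with values in $F^*$ and $\chi(e_i,e_j)=p_{ij}$, and put $p_{uv}=\chi(\deg u,\deg v)$ for homogeneous $u,v$. Let $\mathfrak L(V)$ be the smallest subspace of $\mathfrak B(V)$ that contains $V$ and is closed under the bracket $[u,v]=vu-p_{vu}\,uv$ of homogeneous elements $u,v$, and let $\mathfrak L^-(V)$ be the Lie subalgebra of $\mathfrak B(V)$ generated by $V$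 under $[u,v]^-=vu-uv$. Then $\mathfrak L(V)=\mathfrak L^-(V)$ if and only if $p_{ii}^2=1$ for all $1\le i\le n$ and $p_{ij}=p_{ji}=1$ for all $1\le i\neq j\le n$. In that case $\mathfrak L(V)=\mathfrak L^-(V)=V$. -/

import Mathlib

open scoped BigOperators

namespace NicholsDiag

variable {F : Type*} [Field F] {n : ℕ}

/-- The bicharacter `χ` on `ℤⁿ` with `χ (e_i, e_j) = q_ij`. -/
def bichar (q : Fin n → Fin n → Fˣ) (a b : Fin n → ℤ) : Fˣ :=
  ∏ i, ∏ j, q i j ^ (a i * b j)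

/-- The tensor power `V^{⊗ m}` of the vector space `V` with basis `x_0, …, x_{n-1}`: it has as
basis the tensors `x_{w 0} ⊗ ⋯ ⊗ x_{w (m-1)}`, indexed by the words `w : Fin m → Fin n`. -/
abbrev TPow (F : Type*) [Field F] (n m : ℕ) : Type _ := (Fin m → Fin n) →₀ F

/-- The operator on `V^{⊗ m}` attached to the permutation `σ` by the diagonal braiding
`C (x_i ⊗ x_j) = q_ij x_j ⊗ x_i`: if `σ` is a reduced product of simple transpositions, this is the
corresponding product of copies of `C` acting on adjacent tensor factors. Every pair of factors
whose order is reversed by `σ` is crossed exactly once, with the factor `q` of its two letters, and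
the letter in position `i` is moved to position `σ i`. -/
noncomputable def braidLift (q : Fin n → Fin n → Fˣ) {m : ℕ} (σ : Equiv.Perm (Fin m)) :
    TPow F n m →ₗ[F] TPow F n m :=
  Finsupp.linearCombination F fun w : Fin m → Fin n =>
    Finsupp.single (w ∘ σ.symm)
      (∏ p : Fin m × Fin m with p.1 < p.2 ∧ σ p.2 < σ p.1, (q (w p.1) (w p.2) : F))

/-- The quantum symmetrizer `S_m = ∑_{σ ∈ 𝕊_m} T_σ` on `V^{⊗ m}`. -/
noncomputable def symmetrizer (q : Fin n → Fin n → Fˣ) (m : ℕ) : TPow F n m →ₗ[F] TPow F n m :=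
  ∑ σ : Equiv.Perm (Fin m), braidLift q σ

/-- The inclusion of `V^{⊗ m}` into the tensor algebra `T(V)`, which is the free algebra on
`x_0, …, x_{n-1}`. -/
noncomputable def incl (F : Type*) [Field F] (n m : ℕ) : TPow F n m →ₗ[F] FreeAlgebra F (Fin n) :=
  Finsupp.linearCombination F fun w : Fin m → Fin n =>
    (List.ofFn fun k => FreeAlgebra.ι F (w k)).prod

/-- The defining ideal of the Nichols algebra: the ideal of `T(V)` generated by the kernels of all
the quantum symmetrizers. -/
noncomputable def nicholsIdeal (q : Fin n → Fin n → Fˣ) : TwoSidedIdeal (FreeAlgebra F (Fin n)) :=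
  TwoSidedIdeal.span {t | ∃ (m : ℕ) (u : TPow F n m), symmetrizer q m u = 0 ∧ incl F n m u = t}

/-- The Nichols algebra `𝔅(V)` of the braided vector space `V` of diagonal type with braiding
matrix `q`, i.e. `T(V)` modulo the kernels of the quantum symmetrizers. -/
abbrev NicholsAlgebra (q : Fin n → Fin n → Fˣ) : Type _ := (nicholsIdeal q).ringCon.Quotient

/-- The quotient map `T(V) → 𝔅(V)`. -/
noncomputable def proj (q : Fin n → Fin n → Fˣ) :
    FreeAlgebra F (Fin n) →ₐ[F] NicholsAlgebra q :=
  (nicholsIdeal q).ringCon.mkₐ F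

/-- The generator `x_i` in `𝔅(V)`. -/
noncomputable def gen (q : Fin n → Fin n → Fˣ) (i : Fin n) : NicholsAlgebra q :=
  proj q (FreeAlgebra.ι F i)

/-- The subspace `V ⊆ 𝔅(V)`. -/
noncomputable def V (q : Fin n → Fin n → Fˣ) : Submodule F (NicholsAlgebra q) :=
  Submodule.span F (Set.range (gen q))

/-- The component of `𝔅(V)` of degree `d` for the `ℤⁿ`-grading with `deg x_i = e_i`: the span of the
monomials `x_{w_1} ⋯ x_{w_m}` in which every `x_i` occurs exactly `d_i` times. -/
noncomputable def homogeneousPart (q : Fin n → Fin n → Fˣ) (d : Fin n → ℤ) :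
    Submodule F (NicholsAlgebra q) :=
  Submodule.span F
    {u | ∃ w : List (Fin n), (∀ i, (w.count i : ℤ) = d i) ∧ u = (w.map (gen q)).prod}

/-- The subspace `W` is closed under the braided bracket `[u, v] = v u - p_{vu} u v`, with
`p_{vu} = χ (deg v, deg u)`, of homogeneous elements `u`, `v`. -/
def IsBraidedLieClosed (q : Fin n → Fin n → Fˣ) (W : Submodule F (NicholsAlgebra q)) : Prop :=
  ∀ (d e : Fin n → ℤ) (u v : NicholsAlgebra q), u ∈ W → v ∈ W →
    u ∈ homogeneousPart q d → v ∈ homogeneousPart q e →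
      v * u - (bichar q e d : F) • (u * v) ∈ W

/-- The Nichols braided Lie algebra `𝔏(V)`: the smallest subspace of `𝔅(V)` that contains `V` and is
closed under the braided bracket of homogeneous elements. -/
noncomputable def braidedLie (q : Fin n → Fin n → Fˣ) : Submodule F (NicholsAlgebra q) :=
  sInf {W | V q ≤ W ∧ IsBraidedLieClosed q W}

attribute [local instance] LieRing.ofAssociativeRing

/-- The Nichols Lie algebra `𝔏⁻(V)`: the Lie subalgebra of `𝔅(V)` generated by `V` under the
commutator. (`[u, v]⁻ = v u - u v` and Mathlib's `⁅u, v⁆ = u v - v u` differ by a sign, which does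
not matter for the subalgebra generated.) -/
noncomputable def nicholsLie (q : Fin n → Fin n → Fˣ) : Submodule F (NicholsAlgebra q) :=
  (LieSubalgebra.lieSpan F (NicholsAlgebra q) (V q : Set (NicholsAlgebra q))).toSubmodule

end NicholsDiag

/-! Everything is decided in degree two. There `𝔅(V)` maps to the quantum shuffle algebra with
product `x_i x_j = x_i ⊗ x_j + q_ij x_j ⊗ x_i`, so that products of generators can be compared by
coefficients (`toShuffle`). The bracket `[x_i, x_j]` becomes `(1 - q_ij q_ji) x_j ⊗ x_i`, while the
commutators of `x_i` and `x_j` span the single vector `(1 - q_ij) x_j ⊗ x_i + (q_ji - 1) x_i ⊗ x_j`.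
For `i = j` the commutator vanishes, which forces `q_ii ^ 2 = 1`. For `i ≠ j` one line cannot
contain independent multiples of both tensors, so `q_ij q_ji = 1` (`mul_eq_one_of_braidedLie_le`);
the braided side is then zero at these tensors, so the commutator vanishes too and `q_ij = q_ji =
1`. Conversely, `q_ij q_ji = 1` makes the bracket of generators zero already in `𝔅(V)`
(`gen_mul_gen`), so `V` is closed under both brackets. -/

namespace NicholsDiag

variable {F : Type*} [Field F] {n : ℕ}

/-! ### Truncated quantum shuffle algebra -/

/-- The quantum shuffle algebra of a diagonal braiding, truncated after degree two: an element
consists of its components of degree `0`, `1` and `2`. -/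
def ShuffleTrunc (_q : Fin n → Fin n → Fˣ) : Type _ :=
  F × (Fin n → F) × (Fin n → Fin n → F)

namespace ShuffleTrunc

variable {q : Fin n → Fin n → Fˣ}

noncomputable instance : AddCommGroup (ShuffleTrunc q) :=
  inferInstanceAs (AddCommGroup (F × (Fin n → F) × (Fin n → Fin n → F)))

noncomputable instance : Module F (ShuffleTrunc q) :=
  inferInstanceAs (Module F (F × (Fin n → F) × (Fin n → Fin n → F)))

/-- The component of degree zero. -/
def deg0 : ShuffleTrunc q →ₗ[F] F where
  toFun a := a.1
  map_add' _ _ := rfl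
  map_smul' _ _ := rfl

/-- The coefficient of `x_i`. -/
def deg1 (i : Fin n) : ShuffleTrunc q →ₗ[F] F where
  toFun a := a.2.1 i
  map_add' _ _ := rfl
  map_smul' _ _ := rfl

/-- The coefficient of `x_i ⊗ x_j`. -/
def deg2 (i j : Fin n) : ShuffleTrunc q →ₗ[F] F where
  toFun a := a.2.2 i j
  map_add' _ _ := rfl
  map_smul' _ _ := rfl

theorem ext_deg {a b : ShuffleTrunc q} (h0 : deg0 a = deg0 b) (h1 : ∀ i, deg1 i a = deg1 i b)
    (h2 : ∀ i j, deg2 i j a = deg2 i j b) : a = b :=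
  Prod.ext h0 (Prod.ext (funext h1) (funext fun i => funext (h2 i)))

noncomputable instance : One (ShuffleTrunc q) := ⟨(1, 0, 0)⟩

/-- The last summand is `1 + C` applied to the tensor product of the degree-one parts, which is why
the kernel of `S_2` will be sent to zero. -/
noncomputable instance : Mul (ShuffleTrunc q) :=
  ⟨fun a b => (deg0 a * deg0 b, fun i => deg0 a * deg1 i b + deg1 i a * deg0 b,
    fun i j => deg0 a * deg2 i j b + deg2 i j a * deg0 b +
      (deg1 i a * deg1 j b + (q j i : F) * (deg1 j a * deg1 i b)))⟩

@[simp] theorem deg0_one : deg0 (1 : ShuffleTrunc q) = 1 := rfl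
@[simp] theorem deg1_one (i : Fin n) : deg1 i (1 : ShuffleTrunc q) = 0 := rfl
@[simp] theorem deg2_one (i j : Fin n) : deg2 i j (1 : ShuffleTrunc q) = 0 := rfl

@[simp] theorem deg0_mul (a b : ShuffleTrunc q) : deg0 (a * b) = deg0 a * deg0 b := rfl

@[simp] theorem deg1_mul (i : Fin n) (a b : ShuffleTrunc q) :
    deg1 i (a * b) = deg0 a * deg1 i b + deg1 i a * deg0 b := rfl

@[simp] theorem deg2_mul (i j : Fin n) (a b : ShuffleTrunc q) :
    deg2 i j (a * b) = deg0 a * deg2 i j b + deg2 i j a * deg0 b +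
      (deg1 i a * deg1 j b + (q j i : F) * (deg1 j a * deg1 i b)) := rfl

noncomputable instance : Ring (ShuffleTrunc q) :=
  { (inferInstance : AddCommGroup (ShuffleTrunc q)),
    (inferInstance : One (ShuffleTrunc q)), (inferInstance : Mul (ShuffleTrunc q)) with
    left_distrib := fun a b c => by
      apply ext_deg <;> intros <;> simp <;> ring
    right_distrib := fun a b c => by
      apply ext_deg <;> intros <;> simp <;> ring
    zero_mul := fun a => by apply ext_deg <;> intros <;> simp
    mul_zero := fun a => by apply ext_deg <;> intros <;> simp
    mul_assoc := fun a b c => by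
      apply ext_deg <;> intros <;> simp <;> ring
    one_mul := fun a => by apply ext_deg <;> intros <;> simp
    mul_one := fun a => by apply ext_deg <;> intros <;> simp }

noncomputable instance : Algebra F (ShuffleTrunc q) :=
  Algebra.ofModule
    (fun r a b => by apply ext_deg <;> intros <;> simp <;> ring)
    (fun r a b => by apply ext_deg <;> intros <;> simp <;> ring)

/-- The generator `x_k` of the truncated shuffle algebra. -/
noncomputable def var (q : Fin n → Fin n → Fˣ) (k : Fin n) : ShuffleTrunc q :=
  (0, Pi.single k 1, 0)

@[simp] theorem deg0_var (k : Fin n) : deg0 (var q k) = 0 := rfl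
@[simp] theorem deg2_var (k i j : Fin n) : deg2 i j (var q k) = 0 := rfl
@[simp] theorem deg1_var (k i : Fin n) : deg1 i (var q k) = if k = i then 1 else 0 := by
  change (Pi.single k (1 : F) : Fin n → F) i = _
  rw [Pi.single_apply]
  simp only [eq_comm]

theorem deg0_word (w : List (Fin n)) :
    deg0 (w.map (var q)).prod = if w = [] then 1 else 0 := by
  cases w <;> simp

theorem deg1_word (w : List (Fin n)) (i : Fin n) :
    deg1 i (w.map (var q)).prod = if w = [i] then 1 else 0 := by
  cases w with
  | nil => simp
  | cons k w =>
    simp only [List.map_cons, List.prod_cons, deg1_mul, deg0_var, deg1_var, deg0_word]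
    by_cases h : k = i <;> simp [h]

theorem word_eq_zero (w : List (Fin n)) (h : 3 ≤ w.length) : (w.map (var q)).prod = 0 := by
  match w, h with
  | a :: b :: c :: w, _ =>
    apply ext_deg <;> intros <;> simp

end ShuffleTrunc

open ShuffleTrunc

/-! ### Quantum symmetrizers in degree at most two -/

section Symmetrizer

variable (q : Fin n → Fin n → Fˣ)

theorem braidLift_one (m : ℕ) : braidLift q (1 : Equiv.Perm (Fin m)) = LinearMap.id := by
  ext w : 2
  have hs : w ∘ (1 : Equiv.Perm (Fin m)).symm = w := rfl
  simp only [braidLift, LinearMap.comp_apply, Finsupp.lsingle_apply,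
    Finsupp.linearCombination_single, one_smul, hs, LinearMap.id_apply]
  congr 1
  exact Finset.prod_eq_one fun p hp =>
    absurd (Finset.mem_filter.1 hp).2.2 (lt_asymm (Finset.mem_filter.1 hp).2.1)

theorem symmetrizer_zero : symmetrizer q 0 = LinearMap.id := by
  rw [symmetrizer, Fintype.sum_subsingleton _ 1, braidLift_one]

theorem symmetrizer_one : symmetrizer q 1 = LinearMap.id := by
  rw [symmetrizer, Fintype.sum_subsingleton _ 1, braidLift_one]

theorem symmetrizer_two_single (w : Fin 2 → Fin n) (c : F) :
    symmetrizer q 2 (Finsupp.single w c) =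
      Finsupp.single w c + Finsupp.single ![w 1, w 0] (c * q (w 0) (w 1)) := by
  have hu : (Finset.univ : Finset (Equiv.Perm (Fin 2))) = {1, Equiv.swap 0 1} := by decide
  have hw : w ∘ Equiv.swap (0 : Fin 2) 1 = ![w 1, w 0] := by
    ext k; fin_cases k <;> simp
  have hne : (1 : Equiv.Perm (Fin 2)) ≠ Equiv.swap 0 1 := by decide
  rw [symmetrizer, hu, Finset.sum_pair hne, braidLift_one]
  simp [braidLift, Finset.prod_filter, Fintype.prod_prod_type, hw]

end Symmetrizer

/-! ### Coefficients on the Nichols algebra -/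

section Functionals

variable (q : Fin n → Fin n → Fˣ)

/-- The map from the tensor algebra to the truncated quantum shuffle algebra. -/
noncomputable def toShuffleFree : FreeAlgebra F (Fin n) →ₐ[F] ShuffleTrunc q :=
  FreeAlgebra.lift F (var q)

theorem toShuffleFree_incl_single {m : ℕ} (w : Fin m → Fin n) (c : F) :
    toShuffleFree q (incl F n m (Finsupp.single w c)) =
      c • ((List.ofFn w).map (var q)).prod := by
  simp [incl, toShuffleFree, map_list_prod, List.map_ofFn, Function.comp_def]

theorem deg2_incl_two (i j : Fin n) (u : TPow F n 2) :
    deg2 i j (toShuffleFree q (incl F n 2 u)) = symmetrizer q 2 u ![i, j] := by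
  induction u using Finsupp.induction_linear with
  | zero => simp
  | add u v hu hv => simp [hu, hv]
  | single w c =>
    have h1 : w = ![i, j] ↔ w 0 = i ∧ w 1 = j := by
      simp [funext_iff, Fin.forall_fin_two]
    have h2 : ![w 1, w 0] = ![i, j] ↔ w 1 = i ∧ w 0 = j := by
      simp [funext_iff, Fin.forall_fin_two]
    rw [toShuffleFree_incl_single, symmetrizer_two_single]
    simp only [Finsupp.add_apply, Finsupp.single_apply, h1, h2]
    by_cases a : w 0 = i <;> by_cases b : w 1 = j <;> by_cases c : w 1 = i <;>
      by_cases d : w 0 = j <;> simp_all [mul_add]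

/-- `S_0` and `S_1` are injective, the image in degree two is `S_2 u` itself, and degrees from three
on are truncated away. -/
theorem toShuffleFree_incl_eq_zero {m : ℕ} (u : TPow F n m) (h : symmetrizer q m u = 0) :
    toShuffleFree q (incl F n m u) = 0 := by
  match m, u, h with
  | 0, u, h =>
    rw [symmetrizer_zero] at h
    simp [show u = 0 from h]
  | 1, u, h =>
    rw [symmetrizer_one] at h
    simp [show u = 0 from h]
  | 2, u, h =>
    apply ext_deg
    · clear h
      induction u using Finsupp.induction_linear with
      | zero => simp
      | add u v hu hv => simp_all
      | single w c => simp [toShuffleFree_incl_single]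
    · clear h
      intro i
      induction u using Finsupp.induction_linear with
      | zero => simp
      | add u v hu hv => simp_all
      | single w c => simp [toShuffleFree_incl_single]
    · intro i j
      simp [deg2_incl_two, h]
  | m + 3, u, h =>
    clear h
    induction u using Finsupp.induction_linear with
    | zero => simp
    | add u v hu hv => simp [hu, hv]
    | single w c => rw [toShuffleFree_incl_single, word_eq_zero _ (by simp), smul_zero]

theorem toShuffleFree_eq_of_rel (a b : FreeAlgebra F (Fin n))
    (h : (nicholsIdeal q).ringCon a b) : toShuffleFree q a = toShuffleFree q b := by
  have hle : nicholsIdeal q ≤ TwoSidedIdeal.ker (toShuffleFree q) := by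
    refine TwoSidedIdeal.span_le.2 ?_
    rintro _ ⟨m, u, hu, rfl⟩
    exact (TwoSidedIdeal.mem_ker _).2 (toShuffleFree_incl_eq_zero q u hu)
  have := (TwoSidedIdeal.mem_ker _).1 (hle ((TwoSidedIdeal.rel_iff _ _ _).1 h))
  rwa [map_sub, sub_eq_zero] at this

/-- The map from the Nichols algebra to the truncated quantum shuffle algebra. -/
noncomputable def toShuffle : NicholsAlgebra q →ₐ[F] ShuffleTrunc q :=
  { (nicholsIdeal q).ringCon.lift (toShuffleFree q : FreeAlgebra F (Fin n) →+* ShuffleTrunc q)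
      (toShuffleFree_eq_of_rel q) with
    commutes' := fun r => (toShuffleFree q).commutes r }

@[simp] theorem toShuffle_gen (k : Fin n) : toShuffle q (gen q k) = var q k := by
  change toShuffleFree q (FreeAlgebra.ι F k) = _
  simp [toShuffleFree]

variable {q}

theorem gen_mem_V (i : Fin n) : gen q i ∈ V q := Submodule.subset_span ⟨i, rfl⟩

theorem gen_mem_homogeneousPart (i : Fin n) :
    gen q i ∈ homogeneousPart q (Pi.single i 1) := by
  refine Submodule.subset_span ⟨[i], fun k => ?_, by simp⟩
  by_cases h : i = k <;> simp [h, eq_comm]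

/-- Only elements of degree `e_i` have a non-zero coefficient at `x_i`. -/
theorem degree_eq_of_deg1_ne_zero {d : Fin n → ℤ} {u : NicholsAlgebra q}
    (hu : u ∈ homogeneousPart q d) {i : Fin n} (h : deg1 i (toShuffle q u) ≠ 0) :
    d = Pi.single i 1 := by
  by_contra hd
  refine h ?_
  induction hu using Submodule.span_induction with
  | mem x hx =>
    obtain ⟨w, hw, rfl⟩ := hx
    have : (w.map (gen q)).map (toShuffle q) = w.map (var q) := by
      simp [Function.comp_def]
    rw [map_list_prod, this, deg1_word, if_neg]
    rintro rfl
    refine hd (funext fun k => ?_)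
    rw [← hw k]
    by_cases h : i = k <;> simp [h, eq_comm]
  | zero => simp
  | add x y _ _ hx hy => simp_all
  | smul a x _ hx => simp_all

theorem deg1_eq_zero {d : Fin n → ℤ} {u : NicholsAlgebra q}
    (hu : u ∈ homogeneousPart q d) {i k : Fin n} (h : deg1 i (toShuffle q u) ≠ 0) (hk : i ≠ k) :
    deg1 k (toShuffle q u) = 0 := by
  by_contra h'
  have := congrFun ((degree_eq_of_deg1_ne_zero hu h).symm.trans (degree_eq_of_deg1_ne_zero hu h')) i
  simp [hk] at this

theorem bichar_single (i j : Fin n) :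
    bichar q (Pi.single i 1) (Pi.single j 1) = q i j := by
  unfold bichar
  rw [Finset.prod_eq_single i, Finset.prod_eq_single j]
  · simp
  · intro k _ hk
    simp [hk]
  · simp
  · intro k _ hk
    simp [hk]
  · simp

theorem eq_sum_of_mem_V {u : NicholsAlgebra q} (hu : u ∈ V q) :
    u = ∑ i, deg1 i (toShuffle q u) • gen q i := by
  induction hu using Submodule.span_induction with
  | mem x hx =>
    obtain ⟨k, rfl⟩ := hx
    simp
  | zero => simp
  | add x y _ _ hx hy =>
    simp only [map_add, add_smul, Finset.sum_add_distrib]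
    rw [← hx, ← hy]
  | smul a x _ hx =>
    simp only [map_smul, smul_assoc, ← Finset.smul_sum]
    rw [← hx]

/-- A homogeneous element of `V` is a multiple of a basis vector of the same degree. -/
theorem exists_eq_smul_gen {d : Fin n → ℤ} {u : NicholsAlgebra q} (hu : u ∈ V q)
    (hd : u ∈ homogeneousPart q d) :
    u = 0 ∨ ∃ (i : Fin n) (c : F), d = Pi.single i 1 ∧ u = c • gen q i := by
  by_cases h : ∀ i, deg1 i (toShuffle q u) = 0
  · left
    rw [eq_sum_of_mem_V hu]
    simp [h]
  · right
    push Not at h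
    obtain ⟨i, hi⟩ := h
    refine ⟨i, deg1 i (toShuffle q u), degree_eq_of_deg1_ne_zero hd hi, ?_⟩
    conv_lhs => rw [eq_sum_of_mem_V hu]
    refine Finset.sum_eq_single i (fun k _ hk => ?_) (by simp)
    rw [deg1_eq_zero hd hi hk.symm, zero_smul]

/-- `S_2` sends `x_j ⊗ x_i - q_ji x_i ⊗ x_j` to `(1 - q_ij q_ji) x_j ⊗ x_i`. The case `i = j` is
included; for `q_ii = -1` it reads `x_i ^ 2 = -x_i ^ 2`. -/
theorem gen_mul_gen (i j : Fin n) (h : q i j * q j i = 1) :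
    gen q j * gen q i = (q j i : F) • (gen q i * gen q j) := by
  have hF : (q i j : F) * (q j i : F) = 1 := by rw [← Units.val_mul, h, Units.val_one]
  let u : TPow F n 2 := Finsupp.single ![j, i] 1 - Finsupp.single ![i, j] (q j i : F)
  have hu : symmetrizer q 2 u = 0 := by
    simp only [u, map_sub, symmetrizer_two_single]
    simp [mul_comm (q j i : F), hF, add_comm]
  have hmem : incl F n 2 u ∈ nicholsIdeal q := TwoSidedIdeal.subset_span ⟨2, u, hu, rfl⟩
  have hz : proj q (incl F n 2 u) = 0 :=
    (RingCon.eq _).2 ((TwoSidedIdeal.mem_iff _ _).1 hmem)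
  rw [← sub_eq_zero, ← hz]
  simp [u, incl, gen, sub_eq_add_neg]

end Functionals

/-! ### Comparison of the two Lie algebras -/

section Subspaces

variable {q : Fin n → Fin n → Fˣ}

theorem V_le_braidedLie : V q ≤ braidedLie q := le_sInf fun _ h => h.1

theorem braidedLie_le {W : Submodule F (NicholsAlgebra q)} (hV : V q ≤ W)
    (hW : IsBraidedLieClosed q W) : braidedLie q ≤ W := sInf_le ⟨hV, hW⟩

theorem isBraidedLieClosed_braidedLie : IsBraidedLieClosed q (braidedLie q) := by
  intro d e u v hu hv hd he
  refine Submodule.mem_sInf.2 fun W hW => ?_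
  exact hW.2 d e u v (Submodule.mem_sInf.1 hu W hW) (Submodule.mem_sInf.1 hv W hW) hd he

theorem braided_bracket_gen_mem (i j : Fin n) :
    gen q j * gen q i - (q j i : F) • (gen q i * gen q j) ∈ braidedLie q := by
  have := isBraidedLieClosed_braidedLie (q := q) _ _ _ _ (V_le_braidedLie (gen_mem_V i))
    (V_le_braidedLie (gen_mem_V j)) (gen_mem_homogeneousPart i) (gen_mem_homogeneousPart j)
  rwa [bichar_single] at this

attribute [local instance] LieRing.ofAssociativeRing

theorem V_le_nicholsLie : V q ≤ nicholsLie q := LieSubalgebra.subset_lieSpan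

theorem commutator_gen_mem (i j : Fin n) :
    gen q j * gen q i - gen q i * gen q j ∈ nicholsLie q :=
  LieSubalgebra.lie_mem _ (V_le_nicholsLie (gen_mem_V j)) (V_le_nicholsLie (gen_mem_V i))

theorem nicholsLie_le {W : Submodule F (NicholsAlgebra q)} (hV : V q ≤ W)
    (hW : ∀ u ∈ W, ∀ v ∈ W, u * v - v * u ∈ W) : nicholsLie q ≤ W := by
  let K : LieSubalgebra F (NicholsAlgebra q) :=
    { W with lie_mem' := fun {u v} hu hv => hW u hu v hv }
  have : LieSubalgebra.lieSpan F (NicholsAlgebra q) (V q : Set (NicholsAlgebra q)) ≤ K :=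
    LieSubalgebra.lieSpan_le.2 hV
  exact this

/-- The linear relation between the coefficients of `x_i ⊗ x_j` and `x_j ⊗ x_i` that holds on the
commutators of elements of `V`. -/
theorem deg2_nicholsLie (i j : Fin n) {u : NicholsAlgebra q} (hu : u ∈ nicholsLie q) :
    (1 - (q i j : F)) * deg2 i j (toShuffle q u) =
      ((q j i : F) - 1) * deg2 j i (toShuffle q u) := by
  let W : Submodule F (NicholsAlgebra q) :=
    { carrier := {u | deg0 (toShuffle q u) = 0 ∧ (1 - (q i j : F)) * deg2 i j (toShuffle q u) =
        ((q j i : F) - 1) * deg2 j i (toShuffle q u)}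
      zero_mem' := by simp
      add_mem' := fun {a b} ha hb => ⟨by simp [ha.1, hb.1], by
        simp only [map_add, mul_add, ha.2, hb.2]⟩
      smul_mem' := fun c a ha => ⟨by simp [ha.1], by
        simp only [map_smul, smul_eq_mul]
        linear_combination c * ha.2⟩ }
  have hle : nicholsLie q ≤ W := by
    refine nicholsLie_le (Submodule.span_le.2 ?_) ?_
    · rintro _ ⟨k, rfl⟩
      exact ⟨by simp, by simp⟩
    · rintro a ⟨ha, -⟩ b ⟨hb, -⟩
      refine ⟨by simp [ha], ?_⟩
      -- With `D = a_i b_j - a_j b_i`, the coefficients of the commutator at `x_i ⊗ x_j` and `x_j ⊗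
      -- x_i` are `(1 - q_ji) D` and `(q_ij - 1) D`.
      simp only [map_sub, map_mul, deg2_mul, ha, hb]
      ring
  exact (hle hu).2

/-- In degree `2 e_i`, there are no commutators. -/
theorem deg2_self_nicholsLie (i : Fin n) {u : NicholsAlgebra q} (hu : u ∈ nicholsLie q) :
    deg2 i i (toShuffle q u) = 0 := by
  let W : Submodule F (NicholsAlgebra q) :=
    LinearMap.ker (deg0 ∘ₗ (toShuffle q).toLinearMap) ⊓
      LinearMap.ker (deg2 i i ∘ₗ (toShuffle q).toLinearMap)
  have hle : nicholsLie q ≤ W := by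
    refine nicholsLie_le (Submodule.span_le.2 ?_) ?_
    · rintro _ ⟨k, rfl⟩
      exact ⟨by simp, by simp⟩
    · rintro a ⟨ha, -⟩ b ⟨hb, -⟩
      simp only [SetLike.mem_coe, LinearMap.mem_ker, LinearMap.comp_apply,
        AlgHom.toLinearMap_apply] at ha hb
      refine ⟨by simp [ha], ?_⟩
      -- The coefficient of `a b` is `(1 + q_ii) a_i b_i`, symmetric in `a` and `b`.
      simp only [SetLike.mem_coe, LinearMap.mem_ker, LinearMap.comp_apply,
        AlgHom.toLinearMap_apply, map_sub, map_mul, deg2_mul, ha, hb]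
      ring
  exact (hle hu).2

/-- If `q_ij q_ji = 1`, then the braided Lie algebra vanishes in degree `e_i + e_j`. -/
theorem deg2_braidedLie {i j : Fin n} (hij : i ≠ j) (h : q i j * q j i = 1)
    {u : NicholsAlgebra q} (hu : u ∈ braidedLie q) : deg2 i j (toShuffle q u) = 0 := by
  have hF : (q i j : F) * (q j i : F) = 1 := by rw [← Units.val_mul, h, Units.val_one]
  let W : Submodule F (NicholsAlgebra q) :=
    LinearMap.ker (deg0 ∘ₗ (toShuffle q).toLinearMap) ⊓
      LinearMap.ker (deg2 i j ∘ₗ (toShuffle q).toLinearMap)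
  have hle : braidedLie q ≤ W := by
    refine braidedLie_le (Submodule.span_le.2 ?_) ?_
    · rintro _ ⟨k, rfl⟩
      exact ⟨by simp, by simp⟩
    · rintro d e a b ⟨ha, -⟩ ⟨hb, -⟩ hd he
      simp only [SetLike.mem_coe, LinearMap.mem_ker, LinearMap.comp_apply,
        AlgHom.toLinearMap_apply] at ha hb
      refine ⟨by simp [ha], ?_⟩
      simp only [SetLike.mem_coe, LinearMap.mem_ker, LinearMap.comp_apply,
        AlgHom.toLinearMap_apply, map_sub, map_smul, map_mul, deg2_mul, ha, hb, smul_eq_mul]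
      -- By homogeneity each degree-one part is a multiple of one generator, so only the pairs
      -- `(x_j, x_i)` and `(x_i, x_j)` matter. They contribute the factors `1 - q_ij q_ji` and `q_ji
      -- - q_ji`.
      by_cases ai : deg1 i (toShuffle q a) = 0
      · by_cases aj : deg1 j (toShuffle q a) = 0
        · simp [ai, aj]
        · by_cases bi : deg1 i (toShuffle q b) = 0
          · simp [ai, bi]
          · rw [degree_eq_of_deg1_ne_zero hd aj, degree_eq_of_deg1_ne_zero he bi, bichar_single,
              ai]
            linear_combination (-deg1 j (toShuffle q a) * deg1 i (toShuffle q b)) * hF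
      · have aj := deg1_eq_zero hd ai hij
        by_cases bj : deg1 j (toShuffle q b) = 0
        · simp [aj, bj]
        · rw [degree_eq_of_deg1_ne_zero hd ai, degree_eq_of_deg1_ne_zero he bj, bichar_single, aj]
          ring
  exact (hle hu).2

theorem braidedLie_eq_V (h : ∀ i j, q i j * q j i = 1) : braidedLie q = V q := by
  refine le_antisymm (braidedLie_le le_rfl ?_) V_le_braidedLie
  intro d e u v hu hv hd he
  rcases exists_eq_smul_gen hu hd with rfl | ⟨i, c, rfl, rfl⟩
  · simp
  rcases exists_eq_smul_gen hv he with rfl | ⟨j, c', rfl, rfl⟩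
  · simp
  rw [bichar_single]
  convert (V q).zero_mem
  simp only [smul_mul_assoc, mul_smul_comm, gen_mul_gen i j (h i j), smul_smul]
  rw [← sub_smul]
  convert zero_smul F _
  ring

theorem nicholsLie_eq_V (h : ∀ i j, i ≠ j → q i j = 1) : nicholsLie q = V q := by
  have hcomm : ∀ u ∈ V q, ∀ v ∈ V q, Commute u v := by
    intro u hu v hv
    refine Submodule.span_induction (p := fun u _ => Commute u v) ?_ (Commute.zero_left v)
      (fun _ _ _ _ => Commute.add_left) (fun c _ _ h => h.smul_left c) hu
    rintro _ ⟨i, rfl⟩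
    refine Submodule.span_induction (p := fun v _ => Commute (gen q i) v) ?_
      (Commute.zero_right _) (fun _ _ _ _ => Commute.add_right) (fun c _ _ h => h.smul_right c) hv
    rintro _ ⟨j, rfl⟩
    by_cases hij : i = j
    · subst hij
      exact Commute.refl _
    · have := gen_mul_gen (q := q) i j (by rw [h i j hij, h j i (Ne.symm hij), one_mul])
      rw [h j i (Ne.symm hij), Units.val_one, one_smul] at this
      exact this.symm
  refine le_antisymm (nicholsLie_le le_rfl fun u hu v hv => ?_) V_le_nicholsLie
  rw [(hcomm u hu v hv).eq, sub_self]
  exact zero_mem _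

theorem sq_eq_one_of_braidedLie_le (h : braidedLie q ≤ nicholsLie q) (i : Fin n) :
    q i i ^ 2 = 1 := by
  have := deg2_self_nicholsLie i (h (braided_bracket_gen_mem i i))
  simp at this
  ext
  push_cast
  linear_combination -this

theorem mul_eq_one_of_braidedLie_le (h : braidedLie q ≤ nicholsLie q) {i j : Fin n} (hij : i ≠ j) :
    q i j * q j i = 1 := by
  have h1 := deg2_nicholsLie i j (h (braided_bracket_gen_mem i j))
  have h2 := deg2_nicholsLie i j (h (braided_bracket_gen_mem j i))
  simp [hij, hij.symm] at h1 h2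
  by_contra hne
  have hF : (1 : F) - (q i j : F) * (q j i : F) ≠ 0 := by
    intro h0
    apply hne
    ext
    push_cast
    linear_combination -h0
  -- `h1` and `h2` say that `1 - q_ij q_ji` times `q_ji - 1`, respectively `1 - q_ij`, is zero.
  have h3 : (q j i : F) = 1 := by
    refine sub_eq_zero.1 ((mul_eq_zero.1 ?_).resolve_right hF)
    grind
  have h4 : (q i j : F) = 1 := by
    refine (sub_eq_zero.1 ((mul_eq_zero.1 ?_).resolve_right hF))
    grind
  exact hF (by rw [h3, h4]; ring)

theorem eq_one_of_nicholsLie_le (h : nicholsLie q ≤ braidedLie q) {i j : Fin n} (hij : i ≠ j)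
    (hq : q i j * q j i = 1) : q j i = 1 := by
  have := deg2_braidedLie hij hq (h (commutator_gen_mem i j))
  -- The coefficient of `x_i ⊗ x_j` in `x_j x_i - x_i x_j` is `q_ji - 1`.
  simp [hij, hij.symm] at this
  ext
  push_cast
  linear_combination this

end Subspaces

end NicholsDiag

theorem proposition6p3 {F : Type*} [Field F] [IsAlgClosed F] [CharZero F] {n : ℕ}
    (p : Fin n → Fin n → Fˣ) :
    (NicholsDiag.braidedLie p = NicholsDiag.nicholsLie p ↔
      (∀ i, p i i ^ 2 = 1) ∧ ∀ i j, i ≠ j → p i j = 1 ∧ p j i = 1) ∧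
    (NicholsDiag.braidedLie p = NicholsDiag.nicholsLie p →
      NicholsDiag.braidedLie p = NicholsDiag.V p ∧
      NicholsDiag.nicholsLie p = NicholsDiag.V p) := by
  have hV : (∀ i, p i i ^ 2 = 1) ∧ (∀ i j, i ≠ j → p i j = 1 ∧ p j i = 1) →
      NicholsDiag.braidedLie p = NicholsDiag.V p ∧
      NicholsDiag.nicholsLie p = NicholsDiag.V p := by
    rintro ⟨h1, h2⟩
    refine ⟨NicholsDiag.braidedLie_eq_V fun i j => ?_,
      NicholsDiag.nicholsLie_eq_V fun i j hij => (h2 i j hij).1⟩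
    by_cases hij : i = j
    · rw [← hij, ← sq, h1]
    · rw [(h2 i j hij).1, (h2 i j hij).2, one_mul]
  have hiff : NicholsDiag.braidedLie p = NicholsDiag.nicholsLie p ↔
      (∀ i, p i i ^ 2 = 1) ∧ ∀ i j, i ≠ j → p i j = 1 ∧ p j i = 1 := by
    refine ⟨fun h => ⟨NicholsDiag.sq_eq_one_of_braidedLie_le h.le, fun i j hij => ?_⟩,
      fun h => (hV h).1.trans (hV h).2.symm⟩
    have hq := NicholsDiag.mul_eq_one_of_braidedLie_le h.le hij
    exact ⟨NicholsDiag.eq_one_of_nicholsLie_le h.ge hij.symm (by rw [mul_comm, hq]),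
      NicholsDiag.eq_one_of_nicholsLie_le h.ge hij hq⟩
  exact ⟨hiff, fun h => hV (hiff.1 h)⟩
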